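/- For $x,y\in\mathbb R$ let $T_x$ and $M_y$ be the unitary operators on $L^2(\mathbb R)$ given by $T_xf(t)=f(t-x)$ and $M_yf(t)=e^{2\pi i t y}f(t)$. Let $\mathbb T$ be the unit circle in $\mathbb C$ and let $\mathbb H=\mathbb T\times\mathbb R\times\mathbb R$ be the (reduced) Heisenberg group, with group operation $$(z_1,y_1,x_1)(z_2,y_2,x_2)=\bigl(z_1z_2e^{-2\pi i x_1y_2},\,y_1+y_2,\,x_1+x_2\bigr),$$ equipped with Lebesgue measure on $\mathbb T\times\mathbb R\times\mathbb R$, where $\mathbb T$ has total mass $1$ (this is a Haar measure of $\mathbb H$). Let $Z$ be the center of $\mathbb H$, and for $k\in\mathbb H$ let $L_k$ be the unitary operator on $L^2(\mathbb H)$ given by $L_kF(h)=F(k^{-1}h)$. Consider the following two conjectures. **HRT conjecture.** For every nonzero $\phi\in L^2(\mathbb R)$ and every finite subset $\mathcal F$ of $\mathbb R^2$, the family $(M_yT_x\phi)_{(x,y)\in\mathcal F}$ is linearly independent in $L^2(\mathbb R)$ over $\mathbb C$. **Heisenberg-Translate conjecture.** For every nonzero $F\in L^2(\mathbb H)$ and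 every finite subset $\mathcal F$ of $\mathbb H$ such that the cosets $hZ$, $h\in\mathcal F$, are distinct, the family $(L_hF)_{h\in\mathcal F}$ is linearly independent in $L^2(\mathbb H)$ over $\mathbb C$. **Theorem.** The HRT conjecture fails if and only if the Heisenberg-Translate conjecture fails. -/

import Mathlib

open MeasureTheory
open scoped FourierTransform

noncomputable section

namespace HRT

/-! ### Time-frequency shifts on `L²(ℝ)`

`Real.fourierChar`, written `𝐞`, is the character `𝐞 s = e^{2πis}` of `ℝ`, with values in `Circle`. -/

/-- The Hilbert space `L²(ℝ)` of complex-valued functions. -/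
abbrev L2R : Type := Lp ℂ 2 (volume : Measure ℝ)

/-- The translation operator `T_x f(t) = f(t - x)` on `L²(ℝ)`. -/
def T (x : ℝ) : L2R →ₗᵢ[ℂ] L2R :=
  Lp.compMeasurePreservingₗᵢ ℂ (fun t : ℝ => t - x) (measurePreserving_sub_right volume x)

theorem memLp_modulation (y : ℝ) (f : L2R) :
    MemLp (fun t : ℝ => 𝐞 (t * y) • f t) 2 volume := by
  refine MemLp.of_le (Lp.memLp f) ?_ (Filter.Eventually.of_forall fun t => by
    rw [Circle.norm_smul])
  have h : Continuous fun t : ℝ => 𝐞 (t * y) :=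
    Real.continuous_fourierChar.comp (by fun_prop)
  exact h.aestronglyMeasurable.smul (Lp.aestronglyMeasurable f)

/-- The modulation operator `M_y f(t) = e^{2πity} f(t)` on `L²(ℝ)`. -/
def M (y : ℝ) : L2R →ₗᵢ[ℂ] L2R where
  toFun f := (memLp_modulation y f).toLp _
  map_add' f g := by
    apply Lp.ext
    filter_upwards [(memLp_modulation y (f + g)).coeFn_toLp, (memLp_modulation y f).coeFn_toLp,
      (memLp_modulation y g).coeFn_toLp, Lp.coeFn_add f g,
      Lp.coeFn_add ((memLp_modulation y f).toLp _) ((memLp_modulation y g).toLp _)]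
      with t h1 h2 h3 h4 h5
    rw [h1, h5, Pi.add_apply, h2, h3, h4, Pi.add_apply, smul_add]
  map_smul' c f := by
    apply Lp.ext
    filter_upwards [(memLp_modulation y (c • f)).coeFn_toLp, (memLp_modulation y f).coeFn_toLp,
      Lp.coeFn_smul c f, Lp.coeFn_smul c ((memLp_modulation y f).toLp _)] with t h1 h2 h3 h4
    simp only [RingHom.id_apply]
    rw [h1, h4, Pi.smul_apply, h2, h3, Pi.smul_apply, smul_comm]
  norm_map' f := by
    change ‖(memLp_modulation y f).toLp _‖ = ‖f‖
    refine le_antisymm ?_ ?_ <;> refine Lp.norm_le_norm_of_ae_le ?_ <;>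
      filter_upwards [(memLp_modulation y f).coeFn_toLp] with t h <;>
      rw [h, Circle.norm_smul]

/-- **The HRT conjecture**: for every nonzero `φ ∈ L²(ℝ)` and every finite `S ⊆ ℝ²`, the vectors
`M_y T_x φ`, `(x, y) ∈ S`, are linearly independent in `L²(ℝ)`. -/
def HRTConjecture : Prop :=
  ∀ φ : L2R, φ ≠ 0 → ∀ S : Finset (ℝ × ℝ),
    LinearIndependent ℂ (fun p : S => M p.1.2 (T p.1.1 φ))

/-! ### The (reduced) Heisenberg group -/

/-- The Heisenberg group: the set `𝕋 × ℝ × ℝ` of triples `(z, y, x)`, with the group law below. -/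
@[ext]
structure Heisenberg where
  z : Circle
  y : ℝ
  x : ℝ

namespace Heisenberg

/-- The triple `(z, y, x)` stands for the operator `z M_y T_x`, which gives the group law
`(z₁, y₁, x₁) (z₂, y₂, x₂) = (z₁ z₂ e^{-2πi x₁ y₂}, y₁ + y₂, x₁ + x₂)`. -/
instance : Mul Heisenberg :=
  ⟨fun a b => ⟨a.z * b.z * 𝐞 (-(a.x * b.y)), a.y + b.y, a.x + b.x⟩⟩

instance : One Heisenberg := ⟨⟨1, 0, 0⟩⟩

instance : Inv Heisenberg :=
  ⟨fun a => ⟨a.z⁻¹ * 𝐞 (-(a.x * a.y)), -a.y, -a.x⟩⟩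

theorem mul_def (a b : Heisenberg) :
    a * b = ⟨a.z * b.z * 𝐞 (-(a.x * b.y)), a.y + b.y, a.x + b.x⟩ := rfl

theorem one_def : (1 : Heisenberg) = ⟨1, 0, 0⟩ := rfl

theorem inv_def (a : Heisenberg) :
    a⁻¹ = ⟨a.z⁻¹ * 𝐞 (-(a.x * a.y)), -a.y, -a.x⟩ := rfl

instance : Group Heisenberg :=
  Group.ofLeftAxioms
    (fun a b c => by
      refine Heisenberg.ext ?_ (add_assoc _ _ _) (add_assoc _ _ _)
      simp only [mul_def]
      rw [show -((a.x + b.x) * c.y) = -(a.x * c.y) + -(b.x * c.y) by ring,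
        show -(a.x * (b.y + c.y)) = -(a.x * b.y) + -(a.x * c.y) by ring,
        AddChar.map_add_eq_mul, AddChar.map_add_eq_mul]
      simp only [mul_comm, mul_left_comm, mul_assoc])
    (fun a => by
      refine Heisenberg.ext ?_ (zero_add _) (zero_add _)
      simp [mul_def, one_def])
    (fun a => by
      refine Heisenberg.ext ?_ (neg_add_cancel _) (neg_add_cancel _)
      simp only [mul_def, inv_def, one_def]
      rw [show -(-a.x * a.y) = a.x * a.y by ring, mul_right_comm _ _ a.z, mul_assoc _ _ (𝐞 (a.x * a.y)),
        ← AddChar.map_add_eq_mul]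
      simp)

/-- The identification of the Heisenberg group, as a set, with `𝕋 × ℝ × ℝ`. -/
def equivProd : Heisenberg ≃ Circle × ℝ × ℝ where
  toFun h := (h.z, h.y, h.x)
  invFun p := ⟨p.1, p.2.1, p.2.2⟩
  left_inv _ := rfl
  right_inv _ := rfl

end Heisenberg

/-- The circle carries its Borel `σ`-algebra. -/
instance : MeasurableSpace Circle := borel Circle

instance : BorelSpace Circle := ⟨rfl⟩

/-- Lebesgue (arc length) measure on the circle, of total mass `1`, that is, the normalized Haar
measure. -/
def circleMeasure : Measure Circle := Measure.haarMeasure ⊤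

instance : circleMeasure.IsHaarMeasure := by unfold circleMeasure; infer_instance

namespace Heisenberg

/-- The Borel `σ`-algebra of `𝕋 × ℝ × ℝ`. -/
instance : MeasurableSpace Heisenberg := MeasurableSpace.comap equivProd inferInstance

/-- `equivProd` as an isomorphism of measurable spaces. -/
def measurableEquivProd : Heisenberg ≃ᵐ Circle × ℝ × ℝ where
  toEquiv := equivProd
  measurable_toFun := comap_measurable equivProd
  measurable_invFun := by
    rintro _ ⟨t, ht, rfl⟩
    simpa [← Set.preimage_comp] using ht

/-- Lebesgue measure on `𝕋 × ℝ × ℝ`, which is a Haar measure of the Heisenberg group. -/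
def haar : Measure Heisenberg :=
  (circleMeasure.prod ((volume : Measure ℝ).prod (volume : Measure ℝ))).map measurableEquivProd.symm

theorem measurePreserving_mul_left (k : Heisenberg) :
    MeasurePreserving (fun h : Heisenberg => k * h) haar haar := by
  have hb : MeasurePreserving (fun q : ℝ × ℝ => (k.y + q.1, k.x + q.2))
      ((volume : Measure ℝ).prod volume) ((volume : Measure ℝ).prod volume) :=
    (measurePreserving_add_left volume k.y).prod (measurePreserving_add_left volume k.x)
  have hc : Measurable (Function.uncurry fun (q : ℝ × ℝ) (z : Circle) =>
      k.z * z * 𝐞 (-(k.x * q.1))) := by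
    have : Continuous (Function.uncurry fun (q : ℝ × ℝ) (z : Circle) =>
        k.z * z * 𝐞 (-(k.x * q.1))) :=
      Continuous.mul (by fun_prop) (Real.continuous_fourierChar.comp (by fun_prop))
    exact this.measurable
  have hs := hb.skew_product (μc := circleMeasure) (μd := circleMeasure) hc
    (Filter.Eventually.of_forall fun q => by
      have := (MeasureTheory.measurePreserving_mul_left circleMeasure
        (k.z * 𝐞 (-(k.x * q.1)))).map_eq
      simpa only [mul_right_comm] using this)
  have he : MeasurePreserving measurableEquivProd.symm
      (circleMeasure.prod ((volume : Measure ℝ).prod (volume : Measure ℝ))) haar :=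
    ⟨measurableEquivProd.symm.measurable, rfl⟩
  exact he.comp ((Measure.measurePreserving_swap.comp hs).comp
    (Measure.measurePreserving_swap.comp (he.symm measurableEquivProd.symm)))

end Heisenberg

/-- The Hilbert space `L²(ℍ)` of complex-valued functions. -/
abbrev L2H : Type := Lp ℂ 2 Heisenberg.haar

/-- The left translation operator `L_k F(h) = F(k⁻¹ h)` on `L²(ℍ)`. -/
def L (k : Heisenberg) : L2H →ₗᵢ[ℂ] L2H :=
  Lp.compMeasurePreservingₗᵢ ℂ (fun h : Heisenberg => k⁻¹ * h)
    (Heisenberg.measurePreserving_mul_left k⁻¹)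

/-- **The Heisenberg-Translate conjecture**: for every nonzero `F ∈ L²(ℍ)` and every finite
`S ⊆ ℍ` whose elements lie in distinct cosets of the center of `ℍ`, the vectors `L_h F`, `h ∈ S`,
are linearly independent in `L²(ℍ)`. -/
def HeisenbergTranslateConjecture : Prop :=
  ∀ F : L2H, F ≠ 0 → ∀ S : Finset Heisenberg,
    Set.InjOn (fun h : Heisenberg => (h : Heisenberg ⧸ Subgroup.center Heisenberg)) S →
      LinearIndependent ℂ (fun h : S => L h.1 F)

end HRT

end

open MeasureTheory
open scoped FourierTransform

noncomputable section

namespace HRT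

/-! Each conjecture implies the other.

Heisenberg-Translate implies HRT because the short-time Fourier transform with a window of norm one,
multiplied by `z⁻¹`, is an isometry `gaborL` from `L²(ℝ)` into `L²(ℍ)` which carries `M_y T_x` to
`L_(1,y,x)`. Distinct points `(x, y)` give distinct cosets of the center, so a dependence among
time-frequency shifts would become a forbidden dependence among left translates.

Conversely, assume HRT and let `∑ c_k L_k F = 0` with `F ≠ 0`. Some Fourier coefficient of `F` along
the center, say the `n`-th, is a nonzero function of `(y, x)` in `L²(ℝ²)`. On it `L_k` acts as a
shift by `(k.y, k.x)` followed by a unimodular weight that depends only on `y` (`centralCoeffₗ_L`).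
A Fourier transform in `x` turns the shift in `x` into multiplication by `𝐞 (-(k.x * ξ))`
(`partialFourierL_weightedShift`). For almost every fixed `ξ` this is a relation in `L²(ℝ)` between
the time-frequency shifts, at the points `(k.y, -n * k.x)`, of a single function of `y`, and that
function is nonzero for a nonnull set of `ξ`.

For `n ≠ 0` these points are distinct and HRT already kills the coefficients. For `n = 0` those with
equal `k.y` coincide, and HRT only kills the sum of their coefficients, which is a trigonometric
polynomial in `ξ` with distinct frequencies `-k.x`. Being zero on a nonnull set, it has zero
coefficients, again by HRT (`HRTConjecture.trigPoly_eq_zero`). Summing over coinciding points treats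
all `n` uniformly. -/

open scoped SchwartzMap ContDiff

/-! ### Fourier integrals and Plancherel's theorem on the line. -/

/-- The `L²` Fourier transform of an integrable function is given by the Fourier integral. -/
theorem coeFn_fourier_toLp {f : ℝ → ℂ} (h1 : Integrable f) (h2 : MemLp f 2) :
    ⇑(𝓕 (h2.toLp f) : Lp ℂ 2 (volume : Measure ℝ)) =ᵐ[volume] 𝓕 f := by
  have hcont : Continuous (𝓕 f) :=
    VectorFourier.fourierIntegral_continuous Real.continuous_fourierChar
      (by fun_prop) h1
  -- Both sides are tested against smooth compactly supported `g`. Such `g` is a Schwartz function,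
  -- and on either side the Fourier transform can be moved onto it: by the definition for
  -- distributions on the left, by Fubini on the right.
  refine ae_eq_of_integral_contDiff_smul_eq
    ((Lp.memLp _).locallyIntegrable (by norm_num)) hcont.locallyIntegrable fun g hg hgc => ?_
  have hg1 : ContDiff ℝ ∞ (fun x => (g x : ℂ)) := Complex.ofRealCLM.contDiff.comp hg
  have hg2 : HasCompactSupport (fun x => (g x : ℂ)) := hgc.comp_left (g := Complex.ofReal) rfl
  let s : 𝓢(ℝ, ℂ) := hg2.toSchwartzMap hg1
  have hs : ∀ x, s x = g x := fun x => rfl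
  have key := congrArg (fun d => d s) (Lp.fourier_toTemperedDistribution_eq (h2.toLp f))
  simp only [TemperedDistribution.fourier_apply, Lp.toTemperedDistribution_apply] at key
  have e1 : ∫ x, g x • (𝓕 (h2.toLp f) : Lp ℂ 2 (volume : Measure ℝ)) x
      = ∫ x, s x • (𝓕 (h2.toLp f) : Lp ℂ 2 (volume : Measure ℝ)) x := by
    simp [hs]
  have e2 : ∫ x, g x • 𝓕 f x = ∫ x, s x • 𝓕 f x := by simp [hs]
  rw [e1, e2, ← key]
  have e3 : ∫ x, (𝓕 s) x • (h2.toLp f) x = ∫ x, (𝓕 s) x • f x :=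
    integral_congr_ae (by filter_upwards [h2.coeFn_toLp] with x hx; rw [hx])
  rw [e3]
  have := VectorFourier.integral_fourierIntegral_smul_eq_flip (μ := (volume : Measure ℝ))
    (ν := (volume : Measure ℝ)) (L := innerₗ ℝ) (e := 𝐞)
    Real.continuous_fourierChar (by fun_prop) (s.integrable) h1
  rw [flip_innerₗ] at this
  exact this

/-- **Plancherel's theorem** for integrable and square integrable functions. -/
theorem eLpNorm_fourier {f : ℝ → ℂ} (h1 : Integrable f) (h2 : MemLp f 2) :
    eLpNorm (𝓕 f) 2 volume = eLpNorm f 2 volume := by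
  rw [← eLpNorm_congr_ae (coeFn_fourier_toLp h1 h2), ← eLpNorm_congr_ae h2.coeFn_toLp,
    ← Lp.enorm_def, ← Lp.enorm_def, ← ofReal_norm, ← ofReal_norm, Lp.norm_fourier_eq]

theorem fourier_comp_sub_right (f : ℝ → ℂ) (v ξ : ℝ) :
    𝓕 (fun t => f (t - v)) ξ = 𝐞 (-(v * ξ)) • 𝓕 f ξ := by
  rw [Real.fourier_real_eq, Real.fourier_real_eq,
    ← integral_sub_right_eq_self (fun t => 𝐞 (-(t * ξ)) • f t) v]
  simp only [Circle.smul_def]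
  rw [← integral_smul]
  refine integral_congr_ae (.of_forall fun t => ?_)
  simp only [smul_smul]
  rw [← Circle.coe_mul, ← AddChar.map_add_eq_mul]
  ring_nf

theorem fourier_modulation (f : ℝ → ℂ) (v ξ : ℝ) :
    𝓕 (fun t => 𝐞 (t * v) • f t) ξ = 𝓕 f (ξ - v) := by
  rw [Real.fourier_real_eq, Real.fourier_real_eq]
  refine integral_congr_ae (.of_forall fun t => ?_)
  simp only [smul_smul]
  rw [← AddChar.map_add_eq_mul]
  ring_nf

theorem eLpNorm_two_sq {X : Type*} [MeasurableSpace X] (μ : Measure X) (f : X → ℂ) :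
    eLpNorm f 2 μ ^ 2 = ∫⁻ x, ‖f x‖ₑ ^ 2 ∂μ := by
  have := eLpNorm_nnreal_pow_eq_lintegral (f := f) (μ := μ) (p := 2) (by norm_num)
  simpa using this

theorem eLpNorm_two_congr {X Y : Type*} [MeasurableSpace X] [MeasurableSpace Y] {μ : Measure X}
    {ν : Measure Y} {f : X → ℂ} {g : Y → ℂ}
    (h : ∫⁻ x, ‖f x‖ₑ ^ 2 ∂μ = ∫⁻ x, ‖g x‖ₑ ^ 2 ∂ν) : eLpNorm f 2 μ = eLpNorm g 2 ν := by
  rw [← eLpNorm_two_sq, ← eLpNorm_two_sq] at h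
  exact (ENNReal.pow_right_strictMono two_ne_zero).injective h

/-! ### The partial Fourier transform on `L²(ℝ²)`. -/

/-- The Fourier transform of a function on the plane in its second variable. -/
def partialFourier (f : ℝ × ℝ → ℂ) (p : ℝ × ℝ) : ℂ := 𝓕 (fun b => f (p.1, b)) p.2

theorem ae_ae_of_ae_plane {q : ℝ × ℝ → Prop} (h : ∀ᵐ p, q p) : ∀ᵐ a : ℝ, ∀ᵐ b : ℝ, q (a, b) :=
  Measure.ae_ae_of_ae_prod h

theorem partialFourier_congr {f g : ℝ × ℝ → ℂ} (h : f =ᵐ[volume] g) :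
    ∀ᵐ a, ∀ ξ, partialFourier f (a, ξ) = partialFourier g (a, ξ) := by
  filter_upwards [ae_ae_of_ae_plane h] with a ha ξ
  exact Real.fourier_congr_ae ha ξ

theorem ae_plane_of_ae_fst {q : ℝ × ℝ → Prop} (h : ∀ᵐ a : ℝ, ∀ ξ, q (a, ξ)) : ∀ᵐ p, q p := by
  have : ∀ᵐ p : ℝ × ℝ, ∀ ξ, q (p.1, ξ) := Measure.quasiMeasurePreserving_fst.ae h
  filter_upwards [this] with p hp using hp p.2

theorem partialFourier_congr_ae {f g : ℝ × ℝ → ℂ} (h : f =ᵐ[volume] g) :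
    partialFourier f =ᵐ[volume] partialFourier g :=
  ae_plane_of_ae_fst (partialFourier_congr h)

theorem aestronglyMeasurable_partialFourier {f : ℝ × ℝ → ℂ} (hf : AEStronglyMeasurable f) :
    AEStronglyMeasurable (partialFourier f) := by
  refine ⟨partialFourier (hf.mk f), ?_, partialFourier_congr_ae hf.ae_eq_mk⟩
  have h : StronglyMeasurable fun q : (ℝ × ℝ) × ℝ => 𝐞 (-(q.2 * q.1.2)) • hf.mk f (q.1.1, q.2) := by
    have h1 : Continuous fun q : (ℝ × ℝ) × ℝ => 𝐞 (-(q.2 * q.1.2)) :=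
      Real.continuous_fourierChar.comp (by fun_prop)
    exact h1.stronglyMeasurable.smul (hf.stronglyMeasurable_mk.comp_measurable (by fun_prop))
  have := h.integral_prod_right' (ν := (volume : Measure ℝ))
  convert this using 1
  ext p
  exact Real.fourier_real_eq _ _

theorem ae_memLp_fiber {f : ℝ × ℝ → ℂ} (hf : MemLp f 2) :
    ∀ᵐ a : ℝ, MemLp (fun b => f (a, b)) 2 := by
  have hfin : ∫⁻ p, ‖f p‖ₑ ^ 2 < ⊤ := by
    rw [← eLpNorm_two_sq]
    exact ENNReal.pow_lt_top hf.2
  have hm : AEMeasurable fun p => ‖f p‖ₑ ^ 2 := hf.1.enorm.pow_const 2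
  rw [Measure.volume_eq_prod, lintegral_prod _ hm] at hfin
  have := ae_lt_top' hm.lintegral_prod_right' hfin.ne
  filter_upwards [this, hf.1.prodMk_left] with a ha hma
  refine ⟨hma, ?_⟩
  rw [← eLpNorm_two_sq] at ha
  by_contra h
  rw [not_lt, top_le_iff] at h
  simp [h] at ha

theorem eLpNorm_partialFourier {f : ℝ × ℝ → ℂ} (hf : MemLp f 2)
    (h : ∀ᵐ a : ℝ, Integrable fun b => f (a, b)) :
    eLpNorm (partialFourier f) 2 volume = eLpNorm f 2 volume := by
  refine eLpNorm_two_congr ?_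
  rw [Measure.volume_eq_prod, lintegral_prod _ (hf.1.enorm.pow_const 2),
    lintegral_prod _ ((aestronglyMeasurable_partialFourier hf.1).enorm.pow_const 2)]
  refine lintegral_congr_ae ?_
  filter_upwards [h, ae_memLp_fiber hf] with a h1 h2
  rw [← eLpNorm_two_sq, ← eLpNorm_two_sq, ← eLpNorm_fourier h1 h2]
  rfl

theorem memLp_partialFourier {f : ℝ × ℝ → ℂ} (hf : MemLp f 2)
    (h : ∀ᵐ a : ℝ, Integrable fun b => f (a, b)) : MemLp (partialFourier f) 2 :=
  ⟨aestronglyMeasurable_partialFourier hf.1, by rw [eLpNorm_partialFourier hf h]; exact hf.2⟩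

/-- The Hilbert space `L²(ℝ²)` of complex-valued functions. -/
abbrev L2Plane : Type := Lp ℂ 2 (volume : Measure (ℝ × ℝ))

/-- The square integrable functions whose restrictions to almost all vertical lines are
integrable. -/
def fiberIntegrable : Submodule ℂ L2Plane where
  carrier := {f | ∀ᵐ a : ℝ, Integrable fun b => f (a, b)}
  add_mem' {f g} hf hg := by
    filter_upwards [hf, hg, ae_ae_of_ae_plane (Lp.coeFn_add f g)] with a h1 h2 h3
    exact (h1.add h2).congr (Filter.EventuallyEq.symm h3)
  zero_mem' := by
    filter_upwards [ae_ae_of_ae_plane (Lp.coeFn_zero ℂ 2 (volume : Measure (ℝ × ℝ)))] with a h3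
    exact (integrable_zero ℝ ℂ volume).congr (Filter.EventuallyEq.symm h3)
  smul_mem' c f hf := by
    filter_upwards [hf, ae_ae_of_ae_plane (Lp.coeFn_smul c f)] with a h1 h3
    exact (h1.smul c).congr (Filter.EventuallyEq.symm h3)

/-- Continuous functions with compact support are dense in `L²(ℝ²)`, and all their fibers are
continuous with compact support, hence integrable. -/
theorem dense_fiberIntegrable : DenseRange fiberIntegrable.subtype := by
  intro f
  rw [Metric.mem_closure_range_iff]
  intro ε hε
  obtain ⟨g, hgc, hfg, hg, hgm⟩ := (Lp.memLp f).exists_hasCompactSupport_eLpNorm_sub_le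
    ENNReal.ofNat_ne_top (ε := ENNReal.ofReal (ε / 2)) (by simpa using hε)
  have hmem : hgm.toLp g ∈ fiberIntegrable := by
    change ∀ᵐ a : ℝ, Integrable fun b => hgm.toLp g (a, b)
    filter_upwards [ae_ae_of_ae_plane hgm.coeFn_toLp] with a ha
    refine Integrable.congr ?_ (Filter.EventuallyEq.symm ha)
    refine Continuous.integrable_of_hasCompactSupport (by fun_prop) ?_
    refine HasCompactSupport.intro (hgc.isCompact.image continuous_snd) fun b hb => ?_
    by_contra h
    exact hb ⟨(a, b), subset_tsupport g h, rfl⟩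
  refine ⟨⟨_, hmem⟩, ?_⟩
  have : edist f (hgm.toLp g) ≤ ENNReal.ofReal (ε / 2) := by
    rw [Lp.edist_def]
    refine le_trans (le_of_eq (eLpNorm_congr_ae ?_)) hfg
    filter_upwards [hgm.coeFn_toLp] with p hp
    simp [hp]
  rw [edist_dist, ENNReal.ofReal_le_ofReal_iff (by positivity)] at this
  exact this.trans_lt (by linarith)

theorem partialFourier_add {f g : ℝ × ℝ → ℂ} (hf : ∀ᵐ a : ℝ, Integrable fun b => f (a, b))
    (hg : ∀ᵐ a : ℝ, Integrable fun b => g (a, b)) :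
    partialFourier (f + g) =ᵐ[volume] partialFourier f + partialFourier g := by
  refine ae_plane_of_ae_fst (q := fun p => partialFourier (f + g) p
    = partialFourier f p + partialFourier g p) ?_
  filter_upwards [hf, hg] with a h1 h2 ξ
  exact congrFun (VectorFourier.fourierIntegral_add Real.continuous_fourierChar
    (L := innerₗ ℝ) (by fun_prop) h1 h2) ξ

theorem partialFourier_smul (c : ℂ) (f : ℝ × ℝ → ℂ) :
    partialFourier (c • f) = c • partialFourier f := by
  ext p
  exact congrFun (VectorFourier.fourierIntegral_const_smul 𝐞 volume (innerₗ ℝ)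
    (fun b => f (p.1, b)) c) p.2

/-- The partial Fourier transform on `fiberIntegrable`. -/
def partialFourierₗ : fiberIntegrable →ₗ[ℂ] L2Plane where
  toFun f := (memLp_partialFourier (Lp.memLp f.1) f.2).toLp _
  map_add' f g := by
    apply Lp.ext
    filter_upwards [(memLp_partialFourier (Lp.memLp (f + g).1) (f + g).2).coeFn_toLp,
      (memLp_partialFourier (Lp.memLp f.1) f.2).coeFn_toLp,
      (memLp_partialFourier (Lp.memLp g.1) g.2).coeFn_toLp,
      Lp.coeFn_add ((memLp_partialFourier (Lp.memLp f.1) f.2).toLp _)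
        ((memLp_partialFourier (Lp.memLp g.1) g.2).toLp _),
      partialFourier_congr_ae (Lp.coeFn_add f.1 g.1), partialFourier_add f.2 g.2]
      with p h1 h2 h3 h4 h5 h6
    rw [h1, h4, Pi.add_apply, h2, h3, ← Pi.add_apply, ← h6, ← h5]
    rfl
  map_smul' c f := by
    apply Lp.ext
    filter_upwards [(memLp_partialFourier (Lp.memLp (c • f).1) (c • f).2).coeFn_toLp,
      (memLp_partialFourier (Lp.memLp f.1) f.2).coeFn_toLp,
      Lp.coeFn_smul c ((memLp_partialFourier (Lp.memLp f.1) f.2).toLp _),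
      partialFourier_congr_ae (Lp.coeFn_smul c f.1)] with p h1 h2 h3 h4
    rw [partialFourier_smul] at h4
    simp only [RingHom.id_apply]
    rw [h1, h3, Pi.smul_apply, h2, ← Pi.smul_apply, ← h4]
    rfl

theorem norm_partialFourierₗ (f : fiberIntegrable) :
    ‖partialFourierₗ f‖ = ‖fiberIntegrable.subtype f‖ := by
  change ‖(memLp_partialFourier (Lp.memLp f.1) f.2).toLp _‖ = ‖f.1‖
  rw [Lp.norm_toLp, eLpNorm_partialFourier (Lp.memLp f.1) f.2, ← Lp.norm_def]

/-- The partial Fourier transform on `L²(ℝ²)`, in the second variable. -/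
def partialFourierL : L2Plane →L[ℂ] L2Plane :=
  partialFourierₗ.extendOfNorm fiberIntegrable.subtype

theorem partialFourierL_apply (f : fiberIntegrable) :
    partialFourierL f = partialFourierₗ f :=
  LinearMap.extendOfNorm_eq dense_fiberIntegrable
    ⟨1, fun f => by rw [one_mul, norm_partialFourierₗ]⟩ f

theorem norm_partialFourierL (f : L2Plane) : ‖partialFourierL f‖ = ‖f‖ := by
  refine dense_fiberIntegrable.induction_on f
    (isClosed_eq (by fun_prop) (by fun_prop)) fun g => ?_
  rw [← norm_partialFourierₗ, ← partialFourierL_apply]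
  rfl

/-! ### Weighted shifts -/

section Weighted

variable {X : Type*} [MeasurableSpace X] {μ : Measure X}

theorem memLp_circle_smul {m : X → Circle} (hm : Measurable m) {f : X → ℂ} (hf : MemLp f 2 μ) :
    MemLp (fun x => m x • f x) 2 μ := by
  refine MemLp.of_le hf ?_ (.of_forall fun t => by rw [Circle.norm_smul])
  exact hm.aestronglyMeasurable.smul hf.1

end Weighted

theorem ae_comp_sub {V : Type*} [AddGroup V] [MeasurableSpace V] [MeasurableAdd V] {μ : Measure V}
    [μ.IsAddRightInvariant] {q : V → Prop} (h : ∀ᵐ v ∂μ, q v) (w : V) : ∀ᵐ v ∂μ, q (v - w) :=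
  (measurePreserving_sub_right μ w).quasiMeasurePreserving.ae h

theorem memLp_comp_sub {f : ℝ × ℝ → ℂ} (hf : MemLp f 2) (w : ℝ × ℝ) :
    MemLp (fun p => f (p - w)) 2 :=
  hf.comp_measurePreserving (measurePreserving_sub_right volume w)

/-- The operator `f ↦ m • f(· - w)` on `L²(ℝ²)`. -/
def weightedShift (m : ℝ × ℝ → Circle) (hm : Measurable m) (w : ℝ × ℝ) :
    L2Plane →ₗᵢ[ℂ] L2Plane where
  toFun f := (memLp_circle_smul hm (memLp_comp_sub (Lp.memLp f) w)).toLp _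
  map_add' f g := by
    apply Lp.ext
    filter_upwards [(memLp_circle_smul hm (memLp_comp_sub (Lp.memLp (f + g)) w)).coeFn_toLp,
      (memLp_circle_smul hm (memLp_comp_sub (Lp.memLp f) w)).coeFn_toLp,
      (memLp_circle_smul hm (memLp_comp_sub (Lp.memLp g) w)).coeFn_toLp,
      ae_comp_sub (Lp.coeFn_add f g) w,
      Lp.coeFn_add ((memLp_circle_smul hm (memLp_comp_sub (Lp.memLp f) w)).toLp _)
        ((memLp_circle_smul hm (memLp_comp_sub (Lp.memLp g) w)).toLp _)]
      with t h1 h2 h3 h4 h5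
    rw [h1, h5, Pi.add_apply, h2, h3, h4, Pi.add_apply, smul_add]
  map_smul' c f := by
    apply Lp.ext
    filter_upwards [(memLp_circle_smul hm (memLp_comp_sub (Lp.memLp (c • f)) w)).coeFn_toLp,
      (memLp_circle_smul hm (memLp_comp_sub (Lp.memLp f) w)).coeFn_toLp,
      ae_comp_sub (Lp.coeFn_smul c f) w,
      Lp.coeFn_smul c ((memLp_circle_smul hm (memLp_comp_sub (Lp.memLp f) w)).toLp _)]
      with t h1 h2 h3 h4
    simp only [RingHom.id_apply]
    rw [h1, h4, Pi.smul_apply, h2, h3, Pi.smul_apply, smul_comm]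
  norm_map' f := by
    change ‖(memLp_circle_smul hm (memLp_comp_sub (Lp.memLp f) w)).toLp _‖ = ‖f‖
    rw [Lp.norm_toLp, Lp.norm_def,
      ← eLpNorm_comp_measurePreserving (Lp.aestronglyMeasurable f)
        (measurePreserving_sub_right volume w)]
    congr 1
    exact eLpNorm_congr_norm_ae (.of_forall fun t => Circle.norm_smul _ _)

theorem coeFn_weightedShift (m : ℝ × ℝ → Circle) (hm : Measurable m) (w : ℝ × ℝ) (f : L2Plane) :
    weightedShift m hm w f =ᵐ[volume] fun p => m p • f (p - w) :=
  (memLp_circle_smul hm (memLp_comp_sub (Lp.memLp f) w)).coeFn_toLp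

/-- The weight depends on the first variable only, so it is a constant on each line along which the
transform is taken. The shift in the second variable becomes a character, and the shift in the first
merely relabels the lines. By density, functions with integrable fibers suffice, where the transform
is an honest integral. -/
theorem partialFourierL_weightedShift {m : ℝ → Circle} (hm : Measurable m) (w : ℝ × ℝ)
    (f : L2Plane) :
    partialFourierL (weightedShift (fun p => m p.1) (by fun_prop) w f) =
      weightedShift (fun p => m p.1 * 𝐞 (-(w.2 * p.2)))
        (by have := Real.continuous_fourierChar.measurable; fun_prop) (w.1, 0)
        (partialFourierL f) := by
  refine dense_fiberIntegrable.induction_on f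
    (isClosed_eq (by fun_prop) (by fun_prop)) fun g => ?_
  have hmem : weightedShift (fun p => m p.1) (by fun_prop) w g.1 ∈ fiberIntegrable := by
    change ∀ᵐ a : ℝ, _
    filter_upwards [ae_ae_of_ae_plane (coeFn_weightedShift (fun p => m p.1) (by fun_prop) w g.1),
      ae_comp_sub g.2 w.1] with a h1 h2
    refine Integrable.congr ?_ (Filter.EventuallyEq.symm h1)
    exact (h2.comp_sub_right w.2).smul (m a : ℂ)
  change partialFourierL ((⟨_, hmem⟩ : fiberIntegrable) : L2Plane)
    = weightedShift _ _ _ (partialFourierL g.1)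
  rw [partialFourierL_apply, partialFourierL_apply]
  apply Lp.ext
  have e1 := (memLp_partialFourier (Lp.memLp g.1) g.2).coeFn_toLp
  filter_upwards [(memLp_partialFourier (Lp.memLp _) hmem).coeFn_toLp,
    partialFourier_congr_ae (coeFn_weightedShift (fun p => m p.1) (by fun_prop) w g.1),
    coeFn_weightedShift (fun p => m p.1 * 𝐞 (-(w.2 * p.2)))
        (by have := Real.continuous_fourierChar.measurable; fun_prop) (w.1, 0) (partialFourierₗ g),
    ae_comp_sub e1 (w.1, (0 : ℝ))] with p h1 h2 h3 h4
  refine h1.trans (h2.trans (Eq.trans ?_ h3.symm))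
  refine Eq.trans ?_ (congrArg _ h4.symm)
  change 𝓕 (fun b => m p.1 • g.1 (p.1 - w.1, b - w.2)) p.2 =
    (m p.1 * 𝐞 (-(w.2 * p.2))) • 𝓕 (fun b => g.1 (p.1 - w.1, b)) (p.2 - 0)
  rw [sub_zero, mul_smul, ← fourier_comp_sub_right (fun b => g.1 (p.1 - w.1, b))]
  exact congrFun (VectorFourier.fourierIntegral_const_smul 𝐞 volume (innerₗ ℝ)
    (fun b => g.1 (p.1 - w.1, b - w.2)) (m p.1 : ℂ)) p.2

/-! ### Coordinates on the Heisenberg group and pointwise formulas for the operators. -/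

instance : IsProbabilityMeasure circleMeasure :=
  ⟨by simpa [circleMeasure] using
    Measure.haarMeasure_self (K₀ := (⊤ : TopologicalSpace.PositiveCompacts Circle))⟩

namespace Heisenberg

theorem measurePreserving_equivProd : MeasurePreserving measurableEquivProd haar
    (circleMeasure.prod (volume : Measure (ℝ × ℝ))) :=
  MeasurePreserving.symm measurableEquivProd.symm ⟨measurableEquivProd.symm.measurable, rfl⟩

theorem measurePreserving_plane :
    MeasurePreserving (fun h : Heisenberg => (h.x, h.y)) haar volume :=
  Measure.measurePreserving_swap.comp (measurePreserving_snd.comp measurePreserving_equivProd)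

theorem measurable_z : Measurable fun h : Heisenberg => h.z :=
  measurable_fst.comp measurableEquivProd.measurable

end Heisenberg

theorem coeFn_T (x : ℝ) (f : L2R) : T x f =ᵐ[volume] fun t => f (t - x) :=
  Lp.coeFn_compMeasurePreserving f (measurePreserving_sub_right volume x)

theorem coeFn_M (y : ℝ) (f : L2R) : M y f =ᵐ[volume] fun t => 𝐞 (t * y) • f t :=
  (memLp_modulation y f).coeFn_toLp

theorem coeFn_M_T (x y : ℝ) (f : L2R) :
    M y (T x f) =ᵐ[volume] fun t => 𝐞 (t * y) • f (t - x) := by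
  filter_upwards [coeFn_M y (T x f), coeFn_T x f] with t h1 h2
  rw [h1, h2]

theorem coeFn_L (k : Heisenberg) (F : L2H) :
    L k F =ᵐ[Heisenberg.haar] fun h => F (k⁻¹ * h) :=
  Lp.coeFn_compMeasurePreserving F (Heisenberg.measurePreserving_mul_left k⁻¹)

/-! ### The short-time Fourier transform as an intertwining isometry. -/

/-- The window function of the short-time Fourier transform. -/
def window : ℝ → ℂ := Set.indicator (Set.Icc 0 1) 1

theorem measurable_window : Measurable window := measurable_one.indicator measurableSet_Icc

theorem memLp_window : MemLp window 2 :=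
  memLp_indicator_const 2 measurableSet_Icc 1 (Or.inr (by simp))

theorem lintegral_window (t : ℝ) : ∫⁻ x, ‖window (t - x)‖ₑ ^ 2 = 1 := by
  rw [lintegral_sub_left_eq_self (fun x => ‖window x‖ₑ ^ 2) t]
  have : (fun x => ‖window x‖ₑ ^ 2) = Set.indicator (Set.Icc 0 1) 1 := by
    ext x
    by_cases h : x ∈ Set.Icc (0 : ℝ) 1 <;> simp [window, h]
  rw [this, lintegral_indicator_one measurableSet_Icc]
  simp

/-- The function `f` seen through a sliding window. -/
def windowed (f : ℝ → ℂ) (p : ℝ × ℝ) : ℂ := f p.2 * window (p.2 - p.1)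

theorem integrable_windowed {f : ℝ → ℂ} (hf : MemLp f 2) (x : ℝ) :
    Integrable fun t => windowed f (x, t) :=
  hf.integrable_mul (memLp_window.comp_measurePreserving (measurePreserving_sub_right volume x))

theorem aestronglyMeasurable_windowed {f : ℝ → ℂ} (hf : MemLp f 2) :
    AEStronglyMeasurable (windowed f) :=
  (hf.1.comp_quasiMeasurePreserving Measure.quasiMeasurePreserving_snd).mul
    (measurable_window.comp (by fun_prop :
      Measurable fun p : ℝ × ℝ => p.2 - p.1)).aestronglyMeasurable

/-- By Tonelli, integrate over the position of the window first: the window has norm one, so the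
inner integral is `‖f t‖ₑ ^ 2`. -/
theorem eLpNorm_windowed {f : ℝ → ℂ} (hf : MemLp f 2) :
    eLpNorm (windowed f) 2 volume = eLpNorm f 2 volume := by
  refine eLpNorm_two_congr ?_
  rw [Measure.volume_eq_prod,
    lintegral_prod_symm _ ((aestronglyMeasurable_windowed hf).enorm.pow_const 2)]
  refine lintegral_congr fun t => ?_
  simp only [windowed, enorm_mul, mul_pow]
  rw [lintegral_const_mul _ (by have := measurable_window; fun_prop), lintegral_window, mul_one]

theorem memLp_windowed {f : ℝ → ℂ} (hf : MemLp f 2) : MemLp (windowed f) 2 :=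
  ⟨aestronglyMeasurable_windowed hf, by rw [eLpNorm_windowed hf]; exact hf.2⟩

/-- The short-time Fourier transform of `f`, as a function on the Heisenberg group that transforms
under the center by the character `z ↦ z⁻¹`. -/
def gabor (f : ℝ → ℂ) (h : Heisenberg) : ℂ := h.z⁻¹ • partialFourier (windowed f) (h.x, h.y)

theorem gabor_congr {f g : ℝ → ℂ} (hfg : f =ᵐ[volume] g) : gabor f = gabor g := by
  ext h
  refine congrArg (h.z⁻¹ • ·) (Real.fourier_congr_ae ?_ _)
  filter_upwards [hfg] with t ht
  simp [windowed, ht]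

theorem gabor_add {f g : ℝ → ℂ} (hf : MemLp f 2) (hg : MemLp g 2) :
    gabor (f + g) = gabor f + gabor g := by
  ext h
  have := congrFun (VectorFourier.fourierIntegral_add Real.continuous_fourierChar
    (L := innerₗ ℝ) (by fun_prop) (integrable_windowed hf h.x) (integrable_windowed hg h.x)) h.y
  rw [Pi.add_apply, gabor, gabor, gabor, ← smul_add]
  refine congrArg (h.z⁻¹ • ·) (Eq.trans ?_ this)
  refine congrArg (fun u : ℝ → ℂ => (𝓕 u : ℝ → ℂ) h.y) (funext fun t => ?_)
  simp [windowed, add_mul]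

theorem gabor_smul (c : ℂ) (f : ℝ → ℂ) : gabor (c • f) = c • gabor f := by
  ext h
  have := congrFun (VectorFourier.fourierIntegral_const_smul 𝐞 volume (innerₗ ℝ)
    (fun t => windowed f (h.x, t)) c) h.y
  rw [Pi.smul_apply, gabor, gabor, smul_comm c]
  refine congrArg (h.z⁻¹ • ·) (Eq.trans ?_ this)
  refine congrArg (fun u : ℝ → ℂ => (𝓕 u : ℝ → ℂ) h.y) (funext fun t => ?_)
  simp [windowed, mul_assoc]

theorem aestronglyMeasurable_gabor {f : ℝ → ℂ} (hf : MemLp f 2) :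
    AEStronglyMeasurable (gabor f) Heisenberg.haar :=
  (Heisenberg.measurable_z.inv.aestronglyMeasurable).smul
    ((aestronglyMeasurable_partialFourier (aestronglyMeasurable_windowed hf)).comp_measurePreserving
      Heisenberg.measurePreserving_plane)

theorem eLpNorm_gabor {f : ℝ → ℂ} (hf : MemLp f 2) :
    eLpNorm (gabor f) 2 Heisenberg.haar = eLpNorm f 2 volume := by
  rw [← eLpNorm_windowed hf, ← eLpNorm_partialFourier (memLp_windowed hf)
    (.of_forall fun x => integrable_windowed hf x),
    ← eLpNorm_comp_measurePreserving
      (aestronglyMeasurable_partialFourier (aestronglyMeasurable_windowed hf))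
      Heisenberg.measurePreserving_plane]
  exact eLpNorm_congr_norm_ae (.of_forall fun h => Circle.norm_smul _ _)

theorem memLp_gabor {f : ℝ → ℂ} (hf : MemLp f 2) : MemLp (gabor f) 2 Heisenberg.haar :=
  ⟨aestronglyMeasurable_gabor hf, by rw [eLpNorm_gabor hf]; exact hf.2⟩

/-- Translation of `f` moves the window along with it and modulation shifts the frequency. This
leaves the phase `𝐞 (-(x * (h.y - y)))`, which is exactly what the central coordinate of the product
contributes through the factor `z⁻¹`. -/
theorem gabor_modulation_translation (f : ℝ → ℂ) (x y : ℝ) (h : Heisenberg) :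
    gabor (fun t => 𝐞 (t * y) • f (t - x)) h = gabor f ((⟨1, y, x⟩ : Heisenberg)⁻¹ * h) := by
  have h1 : (fun t => windowed (fun t => 𝐞 (t * y) • f (t - x)) (h.x, t)) =
      fun t => 𝐞 (t * y) • (fun s => windowed f (-x + h.x, s)) (t - x) := by
    ext t
    simp only [windowed, smul_mul_assoc]
    rw [show t - x - (-x + h.x) = t - h.x by ring]
  have h2 : partialFourier (windowed fun t => 𝐞 (t * y) • f (t - x)) (h.x, h.y) =
      𝐞 (-(x * (h.y - y))) • partialFourier (windowed f) (-x + h.x, h.y - y) := by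
    unfold partialFourier
    rw [h1, fourier_modulation (fun t => (fun s => windowed f (-x + h.x, s)) (t - x))]
    exact fourier_comp_sub_right (fun s => windowed f (-x + h.x, s)) x (h.y - y)
  rw [gabor, gabor, h2, smul_smul, Heisenberg.mul_def, Heisenberg.inv_def]
  simp only
  rw [neg_add_eq_sub y]
  congr 1
  simp only [mul_inv_rev, inv_one, one_mul, ← AddChar.map_neg_eq_inv]
  rw [show -(x * (h.y - y)) = -(-(-x * h.y)) + (-(-(x * y))) by ring, AddChar.map_add_eq_mul]
  simp only [mul_comm, mul_left_comm]

/-- The short-time Fourier transform as an isometric embedding of `L²(ℝ)` into `L²(ℍ)`. -/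
def gaborL : L2R →ₗᵢ[ℂ] L2H where
  toFun φ := (memLp_gabor (Lp.memLp φ)).toLp _
  map_add' φ ψ := by
    rw [← MemLp.toLp_add]
    exact MemLp.toLp_congr _ _ (.of_eq (by
      rw [gabor_congr (Lp.coeFn_add φ ψ), gabor_add (Lp.memLp φ) (Lp.memLp ψ)]))
  map_smul' c φ := by
    rw [RingHom.id_apply, ← MemLp.toLp_const_smul]
    exact MemLp.toLp_congr _ _ (.of_eq (by rw [gabor_congr (Lp.coeFn_smul c φ), gabor_smul]))
  norm_map' φ := by
    change ‖(memLp_gabor (Lp.memLp φ)).toLp _‖ = ‖φ‖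
    rw [Lp.norm_toLp, eLpNorm_gabor (Lp.memLp φ), ← Lp.norm_def]

theorem coeFn_gaborL (φ : L2R) : gaborL φ =ᵐ[Heisenberg.haar] gabor φ :=
  (memLp_gabor (Lp.memLp φ)).coeFn_toLp

theorem gaborL_modulation_translation (φ : L2R) (x y : ℝ) :
    gaborL (M y (T x φ)) = L ⟨1, y, x⟩ (gaborL φ) := by
  apply Lp.ext
  filter_upwards [coeFn_gaborL (M y (T x φ)), coeFn_L ⟨1, y, x⟩ (gaborL φ),
    (Heisenberg.measurePreserving_mul_left (⟨1, y, x⟩ : Heisenberg)⁻¹).quasiMeasurePreserving.ae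
      (coeFn_gaborL φ)] with h h1 h2 h3
  rw [h1, h2, h3, gabor_congr (coeFn_M_T x y φ), gabor_modulation_translation]

/-! ### The center of the group, and the implication from Heisenberg-Translate to HRT. -/

theorem eq_zero_of_fourierChar_mul_eq_one {a : ℝ} (h : ∀ t, 𝐞 (t * a) = 1) : a = 0 := by
  by_contra ha
  -- At `t = 1 / (2a)` the character takes the value `-1`.
  have h1 := congrArg (fun z : Circle => (z : ℂ)) (h (1 / 2 / a))
  simp only [div_mul_cancel₀ _ ha, Real.fourierChar_apply, Circle.coe_one] at h1
  rw [show ((2 * Real.pi * (1 / 2) : ℝ) : ℂ) * Complex.I = Real.pi * Complex.I by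
    push_cast; ring, Complex.exp_pi_mul_I] at h1
  norm_num at h1

theorem Heisenberg.mem_center_iff {c : Heisenberg} :
    c ∈ Subgroup.center Heisenberg ↔ c.y = 0 ∧ c.x = 0 := by
  rw [Subgroup.mem_center_iff]
  have key : ∀ g : Heisenberg, g * c = c * g ↔ 𝐞 (-(g.x * c.y)) = 𝐞 (-(c.x * g.y)) := fun g => by
    simp only [Heisenberg.ext_iff, mul_def, add_comm g.y, add_comm g.x, and_self, and_true,
      mul_comm g.z, mul_right_inj]
  simp only [key]
  constructor
  · intro h
    constructor
    · refine eq_zero_of_fourierChar_mul_eq_one fun t => ?_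
      simpa using h ⟨1, 0, -t⟩
    · refine eq_zero_of_fourierChar_mul_eq_one fun t => ?_
      simpa [mul_comm] using (h ⟨1, -t, 0⟩).symm
  · rintro ⟨h1, h2⟩ g
    simp [h1, h2]

theorem Heisenberg.mk_eq_mk_iff {h k : Heisenberg} :
    (h : Heisenberg ⧸ Subgroup.center Heisenberg) = k ↔ h.y = k.y ∧ h.x = k.x := by
  rw [QuotientGroup.eq, mem_center_iff, mul_def, inv_def]
  simp only [neg_add_eq_zero]

theorem hrt_of_heisenbergTranslate (H : HeisenbergTranslateConjecture) : HRTConjecture := by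
  classical
  intro φ hφ S
  let e : ℝ × ℝ → Heisenberg := fun p => ⟨1, p.2, p.1⟩
  have he : ∀ p q, (e p : Heisenberg ⧸ Subgroup.center Heisenberg) = e q → p = q := fun p q h =>
    Prod.ext (Heisenberg.mk_eq_mk_iff.1 h).2 (Heisenberg.mk_eq_mk_iff.1 h).1
  have hF : gaborL φ ≠ 0 := fun h => hφ ((map_eq_zero_iff gaborL gaborL.injective).1 h)
  have hS : Set.InjOn (fun h : Heisenberg => (h : Heisenberg ⧸ Subgroup.center Heisenberg))
      (S.image e) := by
    intro a ha b hb hab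
    simp only [Finset.coe_image, Set.mem_image, Finset.mem_coe] at ha hb
    obtain ⟨p, -, rfl⟩ := ha
    obtain ⟨q, -, rfl⟩ := hb
    rw [he p q hab]
  have hli := H (gaborL φ) hF (S.image e) hS
  refine LinearIndependent.of_comp gaborL.toLinearMap ?_
  have := hli.comp (fun p : S => ⟨e p.1, Finset.mem_image_of_mem e p.2⟩) fun p q hpq =>
    Subtype.ext (he _ _ (congrArg _ (congrArg Subtype.val hpq)))
  convert this using 1
  ext1 p
  exact gaborL_modulation_translation φ p.1.1 p.1.2

/-! ### Fourier coefficients along the center -/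

/-- A square integrable function on the circle whose Fourier coefficients all vanish is zero. -/
theorem ae_eq_zero_of_circle_coeff_eq_zero {f : Circle → ℂ} (hf : MemLp f 2 circleMeasure)
    (h : ∀ n : ℤ, ∫ z, (z ^ n) • f z ∂circleMeasure = 0) : f =ᵐ[circleMeasure] 0 := by
  have hint : Integrable f circleMeasure := hf.integrable (by norm_num)
  have : Fact ((0 : ℝ) < 1) := ⟨one_pos⟩
  let e : AddCircle (1 : ℝ) ≃ₜ Circle := AddCircle.homeomorphCircle one_ne_zero
  have hmul : ∀ u : C(AddCircle (1 : ℝ), ℂ),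
      Integrable (fun z => u (e.symm z) * f z) circleMeasure :=
    fun u => hint.bdd_mul (c := ‖u‖) (by fun_prop) (.of_forall fun z => u.norm_coe_le_norm _)
  -- Integration against `f` is a continuous functional on continuous functions. It vanishes on the
  -- characters, hence everywhere, since trigonometric polynomials are uniformly dense. Density of
  -- continuous functions in `L²` then gives `f = 0`.
  let Λ : C(AddCircle (1 : ℝ), ℂ) →L[ℂ] ℂ := LinearMap.mkContinuous
    { toFun := fun u => ∫ z, u (e.symm z) * f z ∂circleMeasure
      map_add' := fun u v => by
        rw [← integral_add (hmul u) (hmul v)]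
        simp [add_mul]
      map_smul' := fun c u => by
        simp [mul_assoc, integral_const_mul] }
    (∫ z, ‖f z‖ ∂circleMeasure) (fun u => by
      refine (norm_integral_le_integral_norm _).trans ?_
      rw [mul_comm, ← integral_const_mul]
      refine integral_mono (hmul u).norm (hint.norm.const_mul _) fun z => ?_
      simp only [norm_mul]
      gcongr
      exact u.norm_coe_le_norm _)
  have hΛ0 : ∀ u, Λ u = 0 := by
    intro u
    have hle : (Submodule.span ℂ (Set.range <| @fourier 1)).topologicalClosure ≤ Λ.ker := by
      refine Submodule.topologicalClosure_minimal _ ?_ Λ.isClosed_ker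
      rw [Submodule.span_le]
      rintro _ ⟨n, rfl⟩
      change ∫ z, fourier n (e.symm z) * f z ∂circleMeasure = 0
      rw [← h n]
      refine integral_congr_ae (.of_forall fun z => ?_)
      have hz : AddCircle.toCircle (e.symm z) = z := by
        rw [← AddCircle.homeomorphCircle_apply one_ne_zero]
        exact e.apply_symm_apply z
      simp only [fourier_apply, AddCircle.toCircle_zsmul, hz, Circle.smul_def, smul_eq_mul]
    rw [span_fourier_closure_eq_top] at hle
    exact hle (Submodule.mem_top (x := u))
  have hF : hf.toLp f = 0 := by
    refine Dense.eq_zero_of_inner_right ℂ (S := Set.range (ContinuousMap.toLp 2 circleMeasure ℂ))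
      (ContinuousMap.toLp_denseRange ℂ circleMeasure ℂ (by norm_num)) ?_
    rintro _ ⟨g, rfl⟩
    rw [L2.inner_def, ← hΛ0 ((star g).comp (e : C(AddCircle (1 : ℝ), Circle)))]
    change _ = ∫ z, star (g (e (e.symm z))) * f z ∂circleMeasure
    refine integral_congr_ae ?_
    filter_upwards [hf.coeFn_toLp, ContinuousMap.coeFn_toLp (p := 2) (𝕜 := ℂ) circleMeasure g]
      with z h1 h2
    rw [h1, h2, e.apply_symm_apply]
    simp [mul_comm]
  exact (MemLp.toLp_eq_toLp_iff hf MemLp.zero).1 hF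

namespace Heisenberg

/-- The point of the Heisenberg group with given noncentral and central parts. -/
def ofPlane (p : (ℝ × ℝ) × Circle) : Heisenberg := ⟨p.2, p.1.1, p.1.2⟩

theorem measurePreserving_ofPlane :
    MeasurePreserving ofPlane ((volume : Measure (ℝ × ℝ)).prod circleMeasure) haar :=
  (measurePreserving_equivProd.symm measurableEquivProd).comp Measure.measurePreserving_swap

theorem inv_mul_ofPlane (h : Heisenberg) (p : ℝ × ℝ) (z : Circle) :
    h⁻¹ * ofPlane (p, z) =
      ofPlane (p - (h.y, h.x), h.z⁻¹ * 𝐞 (h.x * (p.1 - h.y)) * z) := by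
  simp only [ofPlane, mul_def, inv_def, Prod.fst_sub, Prod.snd_sub]
  refine Heisenberg.ext ?_ (neg_add_eq_sub _ _) (neg_add_eq_sub _ _)
  simp only
  rw [show h.x * (p.1 - h.y) = -(h.x * h.y) + -(-h.x * p.1) by ring, AddChar.map_add_eq_mul]
  simp only [mul_comm, mul_left_comm]

end Heisenberg

open Heisenberg

/-- The Fourier coefficient of `F` along the center of the Heisenberg group. -/
def centralCoeff (n : ℤ) (F : Heisenberg → ℂ) (p : ℝ × ℝ) : ℂ :=
  ∫ z, z ^ n • F (ofPlane (p, z)) ∂circleMeasure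

theorem centralCoeff_congr (n : ℤ) {F G : Heisenberg → ℂ} (h : F =ᵐ[haar] G) :
    centralCoeff n F =ᵐ[volume] centralCoeff n G := by
  filter_upwards [Measure.ae_ae_of_ae_prod (measurePreserving_ofPlane.quasiMeasurePreserving.ae h)]
    with p hp
  refine integral_congr_ae ?_
  filter_upwards [hp] with z hz
  rw [hz]

theorem aestronglyMeasurable_centralCoeff (n : ℤ) {F : Heisenberg → ℂ}
    (hF : AEStronglyMeasurable F haar) : AEStronglyMeasurable (centralCoeff n F) := by
  have h1 : AEStronglyMeasurable (fun q : (ℝ × ℝ) × Circle => q.2 ^ n • F (ofPlane q))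
      ((volume : Measure (ℝ × ℝ)).prod circleMeasure) := by
    have : Continuous fun q : (ℝ × ℝ) × Circle => q.2 ^ n := continuous_snd.zpow n
    exact this.aestronglyMeasurable.smul
      (hF.comp_measurePreserving measurePreserving_ofPlane)
  exact h1.integral_prod_right'

theorem lintegral_ofPlane {F : Heisenberg → ℂ} (hF : AEStronglyMeasurable F haar) :
    ∫⁻ p : ℝ × ℝ, ∫⁻ z, ‖F (ofPlane (p, z))‖ₑ ^ 2 ∂circleMeasure = eLpNorm F 2 haar ^ 2 := by
  rw [← eLpNorm_comp_measurePreserving hF measurePreserving_ofPlane, eLpNorm_two_sq,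
    lintegral_prod _ ((hF.comp_measurePreserving measurePreserving_ofPlane).enorm.pow_const 2)]
  rfl

theorem ae_memLp_ofPlane {F : Heisenberg → ℂ} (hF : MemLp F 2 haar) :
    ∀ᵐ p : ℝ × ℝ, MemLp (fun z => F (ofPlane (p, z))) 2 circleMeasure := by
  have hm := hF.1.comp_measurePreserving measurePreserving_ofPlane
  have := ae_lt_top' (hm.enorm.pow_const 2).lintegral_prod_right' (by
    change ∫⁻ p : ℝ × ℝ, ∫⁻ z, ‖F (ofPlane (p, z))‖ₑ ^ 2 ∂circleMeasure ≠ ⊤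
    rw [lintegral_ofPlane hF.1]
    exact (ENNReal.pow_lt_top hF.2).ne)
  filter_upwards [this, hm.prodMk_left] with a ha hma
  refine ⟨hma, ?_⟩
  simp only [Function.comp] at ha
  rw [← eLpNorm_two_sq] at ha
  by_contra h
  rw [not_lt, top_le_iff] at h
  simp [h] at ha

/-- The circle has mass one, so on each fiber the coefficient is bounded by the `L¹` norm and
therefore by the `L²` norm. -/
theorem memLp_centralCoeff (n : ℤ) {F : Heisenberg → ℂ} (hF : MemLp F 2 haar) :
    MemLp (centralCoeff n F) 2 := by
  refine ⟨aestronglyMeasurable_centralCoeff n hF.1, ?_⟩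
  have : eLpNorm (centralCoeff n F) 2 volume ^ 2 ≤ eLpNorm F 2 haar ^ 2 := by
    rw [eLpNorm_two_sq, ← lintegral_ofPlane hF.1]
    refine lintegral_mono_ae ?_
    filter_upwards [ae_memLp_ofPlane hF] with p hp
    rw [← eLpNorm_two_sq circleMeasure]
    gcongr
    calc ‖centralCoeff n F p‖ₑ ≤ ∫⁻ z, ‖z ^ n • F (ofPlane (p, z))‖ₑ ∂circleMeasure :=
          enorm_integral_le_lintegral_enorm _
      _ = eLpNorm (fun z => F (ofPlane (p, z))) 1 circleMeasure := by
          rw [eLpNorm_one_eq_lintegral_enorm]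
          refine lintegral_congr fun z => ?_
          rw [← ofReal_norm, Circle.norm_smul, ofReal_norm]
      _ ≤ _ := eLpNorm_le_eLpNorm_of_exponent_le (by norm_num) hp.1
  by_contra h
  rw [not_lt, top_le_iff] at h
  rw [h] at this
  exact absurd (ENNReal.pow_lt_top (n := 2) hF.2) (by simpa using this)

theorem ae_integrable_zpow_smul (n : ℤ) {F : Heisenberg → ℂ} (hF : MemLp F 2 haar) :
    ∀ᵐ p : ℝ × ℝ, Integrable (fun z => z ^ n • F (ofPlane (p, z))) circleMeasure := by
  filter_upwards [ae_memLp_ofPlane hF] with p hp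
  exact (memLp_circle_smul (m := fun z => z ^ n) (by fun_prop) hp).integrable (by norm_num)

/-- `centralCoeff` as a linear map between `L²` spaces. -/
def centralCoeffₗ (n : ℤ) : L2H →ₗ[ℂ] L2Plane where
  toFun F := (memLp_centralCoeff n (Lp.memLp F)).toLp _
  map_add' F G := by
    rw [← MemLp.toLp_add]
    refine MemLp.toLp_congr _ _ ((centralCoeff_congr n (Lp.coeFn_add F G)).trans ?_)
    filter_upwards [ae_integrable_zpow_smul n (Lp.memLp F), ae_integrable_zpow_smul n (Lp.memLp G)]
      with p h1 h2
    simp only [centralCoeff, Pi.add_apply, smul_add]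
    exact integral_add h1 h2
  map_smul' c F := by
    rw [RingHom.id_apply, ← MemLp.toLp_const_smul]
    refine MemLp.toLp_congr _ _ ((centralCoeff_congr n (Lp.coeFn_smul c F)).trans (.of_eq ?_))
    ext p
    simp only [centralCoeff, Pi.smul_apply]
    rw [← integral_smul]
    simp only [smul_comm c]

theorem coeFn_centralCoeffₗ (n : ℤ) (F : L2H) :
    centralCoeffₗ n F =ᵐ[volume] centralCoeff n F :=
  (memLp_centralCoeff n (Lp.memLp F)).coeFn_toLp

/-- There are countably many `n`, so for almost every `p` all coefficients of the fiber over `p`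
vanish at once, and the fiber is zero. -/
theorem eq_zero_of_centralCoeffₗ_eq_zero {F : L2H} (h : ∀ n, centralCoeffₗ n F = 0) : F = 0 := by
  have h0 : ∀ᵐ p : ℝ × ℝ, ∀ n, centralCoeff n F p = 0 := ae_all_iff.2 fun n => by
    filter_upwards [coeFn_centralCoeffₗ n F, (Lp.eq_zero_iff_ae_eq_zero).1 (h n)] with p h1 h2
    rw [← h1, h2, Pi.zero_apply]
  have h1 : eLpNorm F 2 haar ^ 2 = 0 := by
    rw [← lintegral_ofPlane (Lp.aestronglyMeasurable F)]
    refine (lintegral_congr_ae ?_).trans lintegral_zero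
    filter_upwards [h0, ae_memLp_ofPlane (Lp.memLp F)] with p h2 h3
    rw [← eLpNorm_two_sq circleMeasure,
      eLpNorm_congr_ae (ae_eq_zero_of_circle_coeff_eq_zero h3 h2)]
    simp
  rw [Lp.eq_zero_iff_ae_eq_zero,
    ← eLpNorm_eq_zero_iff (Lp.aestronglyMeasurable F) (by norm_num : (2 : ENNReal) ≠ 0)]
  simpa using h1

/-- The weight with which translation by `h` acts on the Fourier coefficients along the center. -/
def centralWeight (n : ℤ) (h : Heisenberg) (y : ℝ) : Circle :=
  (h.z⁻¹ * 𝐞 (h.x * (y - h.y))) ^ (-n)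

theorem measurable_centralWeight (n : ℤ) (h : Heisenberg) : Measurable (centralWeight n h) :=
  ((continuous_const.mul (Real.continuous_fourierChar.comp (by fun_prop))).zpow _).measurable

/-- On the fiber over `p`, left translation rotates the circle by `w`. By invariance of the measure
the rotation leaves only the factor `w ^ (-n)`. -/
theorem centralCoeff_comp_inv_mul (n : ℤ) (h : Heisenberg) (F : Heisenberg → ℂ) (p : ℝ × ℝ) :
    centralCoeff n (fun k => F (h⁻¹ * k)) p =
      centralWeight n h p.1 • centralCoeff n F (p - (h.y, h.x)) := by
  simp only [centralCoeff, inv_mul_ofPlane]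
  set w := h.z⁻¹ * 𝐞 (h.x * (p.1 - h.y)) with hw
  have : ∀ z : Circle, z ^ n • F (ofPlane (p - (h.y, h.x), w * z)) =
      w ^ (-n) • ((w * z) ^ n • F (ofPlane (p - (h.y, h.x), w * z))) := fun z => by
    rw [smul_smul, mul_zpow w z, zpow_neg w, inv_mul_cancel_left]
  simp only [this]
  rw [integral_mul_left_eq_self (μ := circleMeasure)
    (fun z => w ^ (-n) • (z ^ n • F (ofPlane (p - (h.y, h.x), z)))) w]
  simp only [Circle.smul_def (w ^ (-n))]
  rw [integral_smul]
  rfl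

theorem centralCoeffₗ_L (n : ℤ) (h : Heisenberg) (F : L2H) :
    centralCoeffₗ n (L h F) =
      weightedShift (fun p => centralWeight n h p.1)
        (by have := measurable_centralWeight n h; fun_prop) (h.y, h.x) (centralCoeffₗ n F) := by
  apply Lp.ext
  filter_upwards [coeFn_centralCoeffₗ n (L h F), centralCoeff_congr n (coeFn_L h F),
    coeFn_weightedShift (fun p => centralWeight n h p.1)
      (by have := measurable_centralWeight n h; fun_prop) (h.y, h.x) (centralCoeffₗ n F),
    ae_comp_sub (coeFn_centralCoeffₗ n F) (h.y, h.x)] with p h1 h2 h3 h4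
  rw [h1, h2, h3, h4, centralCoeff_comp_inv_mul]

/-! ### HRT with repeated points, and the implication from HRT to Heisenberg-Translate. -/

open Heisenberg

theorem coeFn_sum_smul {X ι : Type*} [MeasurableSpace X] {μ : Measure X} (s : Finset ι) (c : ι → ℂ)
    (v : ι → Lp ℂ 2 μ) : ⇑(∑ i ∈ s, c i • v i) =ᵐ[μ] fun x => ∑ i ∈ s, c i * v i x := by
  classical
  induction s using Finset.induction_on with
  | empty =>
    filter_upwards [Lp.coeFn_zero ℂ 2 μ] with x hx
    simpa using hx
  | insert i s hi ih =>
    rw [Finset.sum_insert hi]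
    filter_upwards [Lp.coeFn_add (c i • v i) (∑ i ∈ s, c i • v i), Lp.coeFn_smul (c i) (v i), ih]
      with x h1 h2 h3
    rw [h1, Pi.add_apply, h2, h3, Finset.sum_insert hi]
    rfl

open Classical in
/-- The HRT conjecture, for families of time-frequency shifts with repetitions. -/
theorem HRTConjecture.sum_fiber_eq_zero (H : HRTConjecture) {ι : Type*} (s : Finset ι)
    (p : ι → ℝ × ℝ) (c : ι → ℂ) {f : ℝ → ℂ} (hf : MemLp f 2) (hf0 : ¬ f =ᵐ[volume] 0)
    (h : ∀ᵐ t, ∑ i ∈ s, c i * (𝐞 (t * (p i).2) • f (t - (p i).1)) = 0) (q : ℝ × ℝ) :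
    ∑ i ∈ s with p i = q, c i = 0 := by
  set φ : L2R := hf.toLp f with hφdef
  have hφ : φ ≠ 0 := fun h0 => hf0 ((MemLp.toLp_eq_toLp_iff hf MemLp.zero).1 h0)
  by_cases hq : q ∈ s.image p
  swap
  · refine Finset.sum_eq_zero fun i hi => ?_
    rw [Finset.mem_filter] at hi
    exact absurd (hi.2 ▸ Finset.mem_image_of_mem p hi.1) hq
  have hsum : ∑ i ∈ s, c i • M (p i).2 (T (p i).1 φ) = 0 := by
    rw [Lp.eq_zero_iff_ae_eq_zero]
    have h1 : ∀ᵐ t, ∀ i ∈ s, M (p i).2 (T (p i).1 φ) t = 𝐞 (t * (p i).2) • f (t - (p i).1) :=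
      (ae_ball_iff s.countable_toSet).2 fun i _ => by
        filter_upwards [coeFn_M_T (p i).1 (p i).2 φ, ae_comp_sub hf.coeFn_toLp (p i).1]
          with t h1 h2
        rw [h1, h2]
    filter_upwards [coeFn_sum_smul s c fun i => M (p i).2 (T (p i).1 φ), h, h1] with t h2 h3 h4
    rw [h2, Pi.zero_apply, ← h3]
    exact Finset.sum_congr rfl fun i hi => by rw [h4 i hi]
  -- Grouping equal points gives a relation over the finite set `s.image p`, where HRT applies.
  refine Fintype.linearIndependent_iff.1 (H φ hφ (s.image p))
    (fun q => ∑ i ∈ s with p i = q.1, c i) ?_ ⟨q, hq⟩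
  rw [← hsum, Finset.sum_coe_sort (s.image p)
    fun q => (∑ i ∈ s with p i = q, c i) • M q.2 (T q.1 φ),
    ← Finset.sum_fiberwise_of_maps_to (g := p) (t := s.image p)
      fun i hi => Finset.mem_image_of_mem p hi]
  refine Finset.sum_congr rfl fun q _ => ?_
  rw [Finset.sum_smul]
  refine Finset.sum_congr rfl fun i hi => ?_
  rw [(Finset.mem_filter.1 hi).2]

/-- Under the HRT conjecture, a trigonometric polynomial with distinct frequencies that vanishes on
a set of positive measure is zero. -/
theorem HRTConjecture.trigPoly_eq_zero (H : HRTConjecture) {ι : Type*} (s : Finset ι)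
    (x : ι → ℝ) (hx : Set.InjOn x s) (c : ι → ℂ) {E : Set ℝ} (hE : volume E ≠ 0)
    (h : ∀ ξ ∈ E, ∑ i ∈ s, c i * 𝐞 (ξ * x i) = 0) : ∀ i ∈ s, c i = 0 := by
  classical
  intro i hi
  -- `E` need not be measurable, so it is replaced by the closed zero set `Z` that contains it.
  let Z : Set ℝ := {ξ | ∑ i ∈ s, c i * 𝐞 (ξ * x i) = 0}
  have hZ : IsClosed Z := isClosed_eq (continuous_finsetSum _ fun i _ =>
    continuous_const.mul (continuous_subtype_val.comp
      (Real.continuous_fourierChar.comp (by fun_prop)))) continuous_const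
  have hZ0 : volume Z ≠ 0 := fun h0 => hE (measure_mono_null h h0)
  obtain ⟨B, hB, hBZ, hB0, hBfin⟩ :
      ∃ B, MeasurableSet B ∧ B ⊆ Z ∧ volume B ≠ 0 ∧ volume B ≠ ⊤ := by
    obtain ⟨B, hBm, hB, h1, h2⟩ := Measure.exists_subset_measure_lt_top hZ.measurableSet
      (pos_iff_ne_zero.2 hZ0)
    exact ⟨B, hBm, hB, h1.ne', h2.ne⟩
  have hf : MemLp (B.indicator fun _ => (1 : ℂ)) 2 volume :=
    memLp_indicator_const 2 hB 1 (Or.inr hBfin)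
  have hf0 : ¬ (B.indicator fun _ => (1 : ℂ)) =ᵐ[volume] 0 := by
    rw [Set.indicator_ae_eq_zero]
    simpa [Function.support] using hB0
  -- On the indicator of `B` the polynomial acts as a combination of pure modulations, that is,
  -- shifts at the points `(0, x i)`. This combination is zero because the polynomial vanishes on
  -- `B`.
  have := H.sum_fiber_eq_zero s (fun i => (0, x i)) c hf hf0 (.of_forall fun t => by
    by_cases ht : t ∈ B
    · have hz : ∑ i ∈ s, c i * 𝐞 (t * x i) = 0 := hBZ ht
      simpa [ht, Circle.smul_def] using hz
    · simp [ht]) (0, x i)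
  rw [← this, Finset.sum_eq_single_of_mem i (by simp [hi])]
  intro j hj hji
  simp only [Finset.mem_filter, Prod.mk.injEq, true_and] at hj
  exact absurd (hx hj.1 hi hj.2) hji

/-- As a function of `y` the weight is a constant times the modulation of frequency `-n * h.x`; this
brings the relation into the form that HRT addresses. -/
theorem centralWeight_eq (n : ℤ) (h : Heisenberg) (y : ℝ) :
    centralWeight n h y = centralWeight n h 0 * 𝐞 (y * (-n * h.x)) := by
  have : 𝐞 (y * (-n * h.x)) = 𝐞 (h.x * y) ^ (-n) := by
    rw [← AddChar.map_zsmul_eq_zpow, zsmul_eq_mul]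
    push_cast
    ring_nf
  rw [centralWeight, centralWeight, this, ← mul_zpow, mul_assoc, ← AddChar.map_add_eq_mul]
  ring_nf

theorem ae_eq_zero_of_fiber_ae_eq_zero {f : ℝ × ℝ → ℂ} (hf : MemLp f 2)
    (h : ∀ᵐ a : ℝ, (fun b => f (a, b)) =ᵐ[volume] 0) : f =ᵐ[volume] 0 := by
  have h1 : eLpNorm f 2 volume ^ 2 = 0 := by
    rw [eLpNorm_two_sq, Measure.volume_eq_prod, lintegral_prod _ (hf.1.enorm.pow_const 2)]
    refine (lintegral_congr_ae ?_).trans lintegral_zero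
    filter_upwards [h] with a ha
    rw [← eLpNorm_two_sq, eLpNorm_congr_ae ha]
    simp
  rw [← eLpNorm_eq_zero_iff hf.1 (by norm_num : (2 : ENNReal) ≠ 0)]
  simpa using h1

/-- A relation between left translates of `F` gives a relation between weighted shifts of the
partial Fourier transform of each of its Fourier coefficients along the center. -/
theorem ae_sum_partialFourierL_eq_zero {ι : Type*} (s : Finset ι) (k : ι → Heisenberg) (c : ι → ℂ)
    {F : L2H} (h : ∑ i ∈ s, c i • L (k i) F = 0) (n : ℤ) :
    ∀ᵐ p : ℝ × ℝ, ∑ i ∈ s, c i * ((centralWeight n (k i) p.1 * 𝐞 (-((k i).x * p.2))) •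
      partialFourierL (centralCoeffₗ n F) (p - ((k i).y, 0))) = 0 := by
  have h1 := congrArg (fun G => partialFourierL (centralCoeffₗ n G)) h
  simp only [map_sum, map_smul, map_zero, centralCoeffₗ_L] at h1
  simp only [partialFourierL_weightedShift (measurable_centralWeight n _)] at h1
  rw [Lp.eq_zero_iff_ae_eq_zero] at h1
  have h2 := fun i => coeFn_weightedShift
    (fun p => centralWeight n (k i) p.1 * 𝐞 (-((k i).x * p.2)))
    (by have := Real.continuous_fourierChar.measurable
        have := measurable_centralWeight n (k i)
        fun_prop) ((k i).y, 0) (partialFourierL (centralCoeffₗ n F))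
  filter_upwards [h1, coeFn_sum_smul s c _,
    (ae_ball_iff s.countable_toSet).2 fun i _ => h2 i] with p h3 h4 h5
  rw [h4, Pi.zero_apply] at h3
  rw [← h3]
  exact Finset.sum_congr rfl fun i hi => by rw [h5 i hi]

theorem heisenbergTranslate_of_hrt (H : HRTConjecture) : HeisenbergTranslateConjecture := by
  classical
  intro F hF S hS
  obtain ⟨n, hn⟩ : ∃ n, centralCoeffₗ n F ≠ 0 := by
    by_contra! h
    exact hF (eq_zero_of_centralCoeffₗ_eq_zero h)
  rw [Fintype.linearIndependent_iff]
  intro c hc k₀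
  set W : L2Plane := partialFourierL (centralCoeffₗ n F) with hWdef
  have hW : W ≠ 0 := by
    rw [← norm_ne_zero_iff, hWdef, norm_partialFourierL]
    exact norm_ne_zero_iff.2 hn
  have hswap : MeasurePreserving (Prod.swap : ℝ × ℝ → ℝ × ℝ) volume volume :=
    Measure.measurePreserving_swap
  -- After the swap the frequency `ξ` comes first, so that fibers are functions of `y` for fixed
  -- `ξ`.
  have hWm : MemLp (fun q : ℝ × ℝ => W q.swap) 2 := (Lp.memLp W).comp_measurePreserving hswap
  have hrel := ae_ae_of_ae_plane (hswap.quasiMeasurePreserving.ae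
    (ae_sum_partialFourierL_eq_zero Finset.univ (fun k : S => k.1) c hc n))
  -- The `ξ` at which the coefficients at each point `q` add up to zero. By HRT this contains almost
  -- every `ξ` whose fiber of `W` is nonzero; if `E` were null, `W` would vanish.
  let E : Set ℝ := {ξ | ∀ q : ℝ × ℝ, ∑ k : S with (k.1.y, -(n : ℝ) * k.1.x) = q,
    c k * centralWeight n k.1 0 * 𝐞 (ξ * -k.1.x) = 0}
  have hE : volume E ≠ 0 := by
    intro hE0
    have hz : (fun q : ℝ × ℝ => W q.swap) =ᵐ[volume] 0 := by
      refine ae_eq_zero_of_fiber_ae_eq_zero hWm ?_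
      filter_upwards [measure_eq_zero_iff_ae_notMem.1 hE0, hrel, ae_memLp_fiber hWm] with ξ h1 h2 h3
      by_contra h4
      refine h1 fun q => ?_
      refine H.sum_fiber_eq_zero Finset.univ (fun k : S => (k.1.y, -(n : ℝ) * k.1.x))
        (fun k : S => c k * centralWeight n k.1 0 * 𝐞 (ξ * -k.1.x)) h3 h4 ?_ q
      filter_upwards [h2] with t ht
      rw [← ht]
      refine Finset.sum_congr rfl fun k _ => ?_
      simp only [Prod.swap_prod_mk, Prod.mk_sub_mk, sub_zero]
      rw [centralWeight_eq n k.1 t, show ξ * -k.1.x = -(k.1.x * ξ) by ring]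
      simp only [Circle.smul_def, Circle.coe_mul, smul_eq_mul]
      ring
    refine hW ((Lp.eq_zero_iff_ae_eq_zero).2 ?_)
    filter_upwards [hswap.quasiMeasurePreserving.ae hz] with p hp using hp
  -- Elements over one point share `k.y`, so lying in distinct cosets forces distinct `k.x`. For `n
  -- = 0` this is the only place where the `x` coordinates are told apart.
  have hinj : Set.InjOn (fun k : S => -k.1.x)
      ({k : S | (k.1.y, -(n : ℝ) * k.1.x) = (k₀.1.y, -(n : ℝ) * k₀.1.x)} : Finset S) := by
    intro a ha b hb hab
    simp only [Finset.coe_filter, Finset.mem_univ, true_and, Set.mem_ofPred_eq, Prod.mk.injEq]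
      at ha hb
    exact Subtype.ext (hS a.2 b.2 (mk_eq_mk_iff.2 ⟨ha.1.trans hb.1.symm, neg_injective hab⟩))
  have := H.trigPoly_eq_zero _ _ hinj (fun k => c k * centralWeight n k.1 0) hE
    (fun ξ hξ => hξ _) k₀ (by simp)
  -- The weight lies on the unit circle, so it can be cancelled.
  simpa using this

end HRT

end

theorem theorem1p7 : ¬ HRT.HRTConjecture ↔ ¬ HRT.HeisenbergTranslateConjecture :=
  not_congr ⟨HRT.heisenbergTranslate_of_hrt, HRT.hrt_of_heisenbergTranslate⟩
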